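/- Let $A$ be a unital $C^*$-algebra, let $\alpha : A \to A$ be an injective $*$-endomorphism with $\alpha(1)=1$, let $E$ be a conditional expectation from $A$ onto the range of $\alpha$, and let $\mathcal L = \alpha^{-1}\circ E$. Let $\mathcal T = \mathcal T(A,\alpha,\mathcal L)$ be the universal unital $C^*$-algebra generated by a copy of $A$ and an element $\hat S$ subject to the relations $\hat S a = \alpha(a)\hat S$ and $\hat S^* a \hat S = \mathcal L(a)$ for all $a \in A$. A redundancy is a pair $(a,k)$ with $a\in A$ and $k$ in the closed linear span of $A\hat S\hat S^*A$ such that $ab\hat S = kb\hat S$ for all $b\in A$. Let $A\rtimes_{\alpha,\mathcal L}\mathbb N$ be the quotient of $\mathcal T$ by the closed two-sided ideal generated by the differences $a-k$ for all redundancies $(a,k)$, let $q$ be the quotient map, and let $S = q(\hat S)$. Let $h$ be a self-adjoint element of the center of $A$ such that $h \geq cI$ for some real number $c>1$. Let $\hat\sigma$ be the one-parameter group of automorphisms of $\mathcal T$ such that $\hat\sigma_t(\hat S) = h^{it}\hat S$ and $\hat\sigma_t(a)=a$ for $a \in A$, $t\in\mathbb R$, and let $\sigma$ be the group of automorphisms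 of $A\rtimes_{\alpha,\mathcal L}\mathbb N$ obtained from $\hat\sigma$ by passage to the quotient. For $\beta>0$, a $\mathrm{KMS}_\beta$ state on $\mathcal T$ (respectively on $A\rtimes_{\alpha,\mathcal L}\mathbb N$) is a state $\psi$ with $\psi(x\tau_{i\beta}(y)) = \psi(yx)$ for all elements $x,y$ that are analytic for $\tau$, where $\tau=\hat\sigma$ (respectively $\tau=\sigma$); an element $y$ is analytic if $t\mapsto\tau_t(y)$ extends to an entire function $z\mapsto\tau_z(y)$. Let $\beta>0$. Then: 1. Every $\mathrm{KMS}_\beta$ state $\psi$ on $\mathcal T(A,\alpha,\mathcal L)$ satisfies $\psi(a\hat S^n\hat S^{*m}b)=0$ for all $a,b\in A$ and all $n,m\in\mathbb N$ with $n\neq m$. 2. Every $\mathrm{KMS}_\beta$ state $\psi$ on $A\rtimes_{\alpha,\mathcal L}\mathbb N$ satisfies $\psi(q(a)S^nS^{*m}q(b))=0$ for all $a,b\in A$ and all $n,m\in\mathbb N$ with $n\neq m$. -/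

import Mathlib

universe u v

set_option linter.unusedSectionVars false

noncomputable section

namespace ExelCP

/-! ### The free unital complex `*`-algebra on a set of generators -/

/-- The free unital `*`-algebra over `ℂ` on a set `X`: the free algebra on the symbols
`x` (`Sum.inl x`) and `x*` (`Sum.inr x`). -/
def FreeStar (X : Type u) : Type u := FreeAlgebra ℂ (X ⊕ X)

namespace FreeStar

variable {X : Type u}

instance : Ring (FreeStar X) := inferInstanceAs (Ring (FreeAlgebra ℂ (X ⊕ X)))

instance : Algebra ℂ (FreeStar X) := inferInstanceAs (Algebra ℂ (FreeAlgebra ℂ (X ⊕ X)))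

/-- The generators. -/
def of (x : X) : FreeStar X := FreeAlgebra.ι ℂ (Sum.inl x)

/-- The formal adjoints of the generators. -/
def ofStar (x : X) : FreeStar X := FreeAlgebra.ι ℂ (Sum.inr x)

theorem induction {p : FreeStar X → Prop} (h0 : ∀ r : ℂ, p (algebraMap ℂ (FreeStar X) r))
    (h1 : ∀ x, p (of x)) (h2 : ∀ x, p (ofStar x)) (hm : ∀ a b, p a → p b → p (a * b))
    (ha : ∀ a b, p a → p b → p (a + b)) (a : FreeStar X) : p a :=
  FreeAlgebra.induction ℂ (X ⊕ X) (motive := p) h0 (by rintro (x | x); exacts [h1 x, h2 x]) hm ha a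

/-- The opposite algebra of `FreeStar X` as a complex algebra with conjugated scalars. -/
def ConjOp (X : Type u) : Type u := (FreeStar X)ᵐᵒᵖ

instance : Ring (ConjOp X) := inferInstanceAs (Ring (FreeStar X)ᵐᵒᵖ)

instance : Algebra ℂ (ConjOp X) :=
  Algebra.compHom (FreeStar X)ᵐᵒᵖ (starRingEnd ℂ)

/-- The adjoint operation, as a homomorphism into the conjugate opposite algebra. -/
def adjHom : FreeStar X →ₐ[ℂ] ConjOp X :=
  FreeAlgebra.lift ℂ (Sum.elim (fun x => MulOpposite.op (ofStar x))
    (fun x => MulOpposite.op (of x)))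

/-- The adjoint operation of the free `*`-algebra: the conjugate-linear antimultiplicative map
which exchanges `x` and `x*`. -/
def adj (a : FreeStar X) : FreeStar X := MulOpposite.unop (adjHom a : (FreeStar X)ᵐᵒᵖ)

theorem adj_of (x : X) : adj (of x) = ofStar x :=
  congrArg MulOpposite.unop (FreeAlgebra.lift_ι_apply (R := ℂ) (A := ConjOp X) _ (Sum.inl x))

theorem adj_ofStar (x : X) : adj (ofStar x) = of x :=
  congrArg MulOpposite.unop (FreeAlgebra.lift_ι_apply (R := ℂ) (A := ConjOp X) _ (Sum.inr x))

theorem adj_add (a b : FreeStar X) : adj (a + b) = adj a + adj b :=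
  congrArg MulOpposite.unop (map_add adjHom a b)

theorem adj_mul (a b : FreeStar X) : adj (a * b) = adj b * adj a :=
  congrArg MulOpposite.unop (map_mul adjHom a b)

theorem adj_algebraMap (r : ℂ) :
    adj (algebraMap ℂ (FreeStar X) r) = algebraMap ℂ (FreeStar X) (star r) :=
  congrArg MulOpposite.unop ((adjHom (X := X)).commutes r)

instance : StarRing (FreeStar X) where
  star := adj
  star_involutive a := by
    induction a using FreeStar.induction with
    | h0 r => rw [adj_algebraMap, adj_algebraMap, star_star]
    | h1 x => rw [adj_of, adj_ofStar]
    | h2 x => rw [adj_ofStar, adj_of]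
    | hm a b ha hb => rw [adj_mul, adj_mul, ha, hb]
    | ha a b ha hb => rw [adj_add, adj_add, ha, hb]
  star_mul := adj_mul
  star_add := adj_add

theorem star_of (x : X) : star (of x) = ofStar x := adj_of x

theorem star_ofStar (x : X) : star (ofStar x) = of x := adj_ofStar x

theorem star_algebraMap (r : ℂ) :
    star (algebraMap ℂ (FreeStar X) r) = algebraMap ℂ (FreeStar X) (star r) := adj_algebraMap r

instance : StarModule ℂ (FreeStar X) where
  star_smul r a := by
    rw [Algebra.smul_def, star_mul, star_algebraMap, Algebra.smul_def]
    exact (Algebra.commutes _ _).symm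

/-- The `*`-homomorphism defined by the images of the generators. -/
def lift {B : Type v} [Ring B] [StarRing B] [Algebra ℂ B] [StarModule ℂ B] (f : X → B) :
    FreeStar X →⋆ₐ[ℂ] B where
  toAlgHom := FreeAlgebra.lift ℂ (Sum.elim f (fun x => star (f x)))
  map_star' a := by
    set φ : FreeStar X →ₐ[ℂ] B := FreeAlgebra.lift ℂ (Sum.elim f (fun x => star (f x))) with hφ
    have e1 : ∀ x, φ (of x) = f x := fun x => FreeAlgebra.lift_ι_apply (R := ℂ) _ _
    have e2 : ∀ x, φ (ofStar x) = star (f x) := fun x => FreeAlgebra.lift_ι_apply (R := ℂ) _ _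
    change φ (star a) = star (φ a)
    induction a using FreeStar.induction with
    | h0 r => rw [star_algebraMap, AlgHom.commutes, AlgHom.commutes, ← algebraMap_star_comm]
    | h1 x => rw [star_of, e1, e2]
    | h2 x => rw [star_ofStar, e1, e2, star_star]
    | hm a b ha hb => rw [star_mul, map_mul, map_mul, star_mul, ha, hb]
    | ha a b ha hb => rw [star_add, map_add, map_add, star_add, ha, hb]

theorem lift_of {B : Type v} [Ring B] [StarRing B] [Algebra ℂ B] [StarModule ℂ B] (f : X → B)
    (x : X) : lift f (of x) = f x :=
  FreeAlgebra.lift_ι_apply (R := ℂ) _ _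

end FreeStar

/-! ### `C*`-seminorms and the associated `C*`-algebras -/

/-- A `C*`-seminorm on a complex `*`-algebra. -/
structure CStarSeminorm (F : Type u) [Ring F] [StarRing F] [Algebra ℂ F] extends
    Seminorm ℂ F where
  mul_le' : ∀ x y, toFun (x * y) ≤ toFun x * toFun y
  star_mul_self' : ∀ x, toFun (star x * x) = toFun x * toFun x

namespace CStarSeminorm

variable {F : Type u} [Ring F] [StarRing F] [Algebra ℂ F] [StarModule ℂ F]

instance : CoeFun (CStarSeminorm F) (fun _ => F → ℝ) := ⟨fun p => p.toSeminorm⟩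

theorem mul_le (p : CStarSeminorm F) (x y : F) : p (x * y) ≤ p x * p y := p.mul_le' x y

theorem star_mul_self (p : CStarSeminorm F) (x : F) : p (star x * x) = p x * p x :=
  p.star_mul_self' x

theorem le_star (p : CStarSeminorm F) (x : F) : p x ≤ p (star x) := by
  rcases (apply_nonneg p.toSeminorm x).eq_or_lt with h | h
  · rw [← h]; exact apply_nonneg p.toSeminorm _
  · refine le_of_mul_le_mul_right ?_ h
    rw [← star_mul_self]; exact p.mul_le _ _

theorem star_eq (p : CStarSeminorm F) (x : F) : p (star x) = p x :=
  le_antisymm (by simpa using p.le_star (star x)) (p.le_star x)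

/-- The `*`-algebra `F`, equipped with the `C*`-seminorm `p`. -/
def Pre (_p : CStarSeminorm F) : Type u := F

variable (p : CStarSeminorm F)

instance : Ring p.Pre := inferInstanceAs (Ring F)
instance : StarRing p.Pre := inferInstanceAs (StarRing F)
instance : Algebra ℂ p.Pre := inferInstanceAs (Algebra ℂ F)
instance : StarModule ℂ p.Pre := inferInstanceAs (StarModule ℂ F)

instance : SeminormedRing p.Pre :=
  RingSeminorm.toSeminormedRing (R := p.Pre)
    { p.toSeminorm.toAddGroupSeminorm with mul_le' := p.mul_le }

theorem norm_pre (x : p.Pre) : ‖x‖ = p (show F from x) := rfl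

instance : NormedSpace ℂ p.Pre where
  norm_smul_le c x := (map_smul_eq_mul p.toSeminorm c (show F from x)).le

instance : NormedStarGroup p.Pre where
  norm_star_le x := (p.star_eq (show F from x)).le

/-- The `C*`-algebra obtained from `F` by separation and completion with respect to `p`. -/
def Compl : Type u := UniformSpace.Completion p.Pre

instance : NormedRing p.Compl := inferInstanceAs (NormedRing (UniformSpace.Completion p.Pre))
instance : CompleteSpace p.Compl :=
  inferInstanceAs (CompleteSpace (UniformSpace.Completion p.Pre))
instance : NormedSpace ℂ p.Compl :=
  inferInstanceAs (NormedSpace ℂ (UniformSpace.Completion p.Pre))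

/-- The canonical map of `F` to its completion. -/
def toCompl (x : F) : p.Compl := ((show p.Pre from x : p.Pre) : UniformSpace.Completion p.Pre)

theorem norm_toCompl (x : F) : ‖p.toCompl x‖ = p x :=
  UniformSpace.Completion.norm_coe (E := p.Pre) x

theorem toCompl_mul (x y : F) : p.toCompl (x * y) = p.toCompl x * p.toCompl y :=
  UniformSpace.Completion.coe_mul (α := p.Pre) x y
theorem toCompl_one : p.toCompl 1 = 1 := rfl
theorem toCompl_add (x y : F) : p.toCompl (x + y) = p.toCompl x + p.toCompl y :=
  UniformSpace.Completion.coe_add (α := p.Pre) x y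
theorem toCompl_smul (c : ℂ) (x : F) : p.toCompl (c • x) = c • p.toCompl x :=
  UniformSpace.Completion.coe_smul (X := p.Pre) c x

theorem denseRange_toCompl : DenseRange p.toCompl :=
  UniformSpace.Completion.denseRange_coe (α := p.Pre)

theorem compl_induction {P : p.Compl → Prop} (x : p.Compl) (hc : IsClosed {x | P x})
    (h : ∀ x : F, P (p.toCompl x)) : P x :=
  UniformSpace.Completion.induction_on (α := p.Pre) x hc h

theorem smul_mul_compl (r : ℂ) (x y : p.Compl) : (r • x) * y = r • (x * y) := by
  have h1 : ∀ y : p.Compl, Continuous fun x : p.Compl => (r • x) * y := fun y =>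
    (continuous_const_smul r).mul continuous_const
  have h2 : ∀ y : p.Compl, Continuous fun x : p.Compl => r • (x * y) := fun y =>
    (continuous_id.mul continuous_const).const_smul r
  have h3 : ∀ x : p.Compl, Continuous fun y : p.Compl => (r • x) * y := fun x =>
    continuous_const.mul continuous_id
  have h4 : ∀ x : p.Compl, Continuous fun y : p.Compl => r • (x * y) := fun x =>
    (continuous_const.mul continuous_id).const_smul r
  refine p.compl_induction x (isClosed_eq (h1 y) (h2 y)) fun x => ?_
  refine p.compl_induction y (isClosed_eq (h3 _) (h4 _)) fun y => ?_
  rw [← toCompl_smul, ← toCompl_mul, ← toCompl_mul, ← toCompl_smul, smul_mul_assoc]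

theorem mul_smul_compl (r : ℂ) (x y : p.Compl) : x * (r • y) = r • (x * y) := by
  have h1 : ∀ y : p.Compl, Continuous fun x : p.Compl => x * (r • y) := fun y =>
    continuous_id.mul continuous_const
  have h2 : ∀ y : p.Compl, Continuous fun x : p.Compl => r • (x * y) := fun y =>
    (continuous_id.mul continuous_const).const_smul r
  have h3 : ∀ x : p.Compl, Continuous fun y : p.Compl => x * (r • y) := fun x =>
    continuous_const.mul (continuous_const_smul r)
  have h4 : ∀ x : p.Compl, Continuous fun y : p.Compl => r • (x * y) := fun x =>
    (continuous_const.mul continuous_id).const_smul r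
  refine p.compl_induction x (isClosed_eq (h1 y) (h2 y)) fun x => ?_
  refine p.compl_induction y (isClosed_eq (h3 _) (h4 _)) fun y => ?_
  rw [← toCompl_smul, ← toCompl_mul, ← toCompl_mul, ← toCompl_smul, mul_smul_comm]

instance : Algebra ℂ p.Compl := Algebra.ofModule p.smul_mul_compl p.mul_smul_compl

instance : NormedAlgebra ℂ p.Compl where
  norm_smul_le := norm_smul_le

/-- The adjoint operation on the completion. -/
def starCompl : p.Compl → p.Compl :=
  UniformSpace.Completion.map (α := p.Pre) (β := p.Pre) star

theorem continuous_starCompl : Continuous p.starCompl :=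
  UniformSpace.Completion.continuous_map

theorem starCompl_toCompl (x : F) : p.starCompl (p.toCompl x) = p.toCompl (star x) :=
  UniformSpace.Completion.map_coe (α := p.Pre) (β := p.Pre)
    (starₗᵢ (E := p.Pre) ℂ).isometry.uniformContinuous x

instance : StarRing p.Compl where
  star := p.starCompl
  star_involutive x := by
    have hc := p.continuous_starCompl
    refine p.compl_induction (P := fun x => p.starCompl (p.starCompl x) = x) x
      (isClosed_eq (by fun_prop) (by fun_prop)) fun x => ?_
    rw [starCompl_toCompl, starCompl_toCompl, star_star]
  star_mul x y := by
    have hc := p.continuous_starCompl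
    refine p.compl_induction
      (P := fun x => p.starCompl (x * y) = p.starCompl y * p.starCompl x) x
      (isClosed_eq (by fun_prop) (by fun_prop)) fun x => ?_
    refine p.compl_induction (P := fun y => p.starCompl (p.toCompl x * y) =
      p.starCompl y * p.starCompl (p.toCompl x)) y
      (isClosed_eq (by fun_prop) (by fun_prop)) fun y => ?_
    rw [← toCompl_mul, starCompl_toCompl, starCompl_toCompl, starCompl_toCompl, star_mul,
      toCompl_mul]
  star_add x y := by
    have hc := p.continuous_starCompl
    refine p.compl_induction
      (P := fun x => p.starCompl (x + y) = p.starCompl x + p.starCompl y) x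
      (isClosed_eq (by fun_prop) (by fun_prop)) fun x => ?_
    refine p.compl_induction (P := fun y => p.starCompl (p.toCompl x + y) =
      p.starCompl (p.toCompl x) + p.starCompl y) y
      (isClosed_eq (by fun_prop) (by fun_prop)) fun y => ?_
    rw [← toCompl_add, starCompl_toCompl, starCompl_toCompl, starCompl_toCompl, star_add,
      toCompl_add]

theorem star_toCompl (x : F) : star (p.toCompl x) = p.toCompl (star x) := p.starCompl_toCompl x

instance : ContinuousStar p.Compl := ⟨p.continuous_starCompl⟩

theorem star_smul_compl (r : ℂ) (x : p.Compl) : star (r • x) = star r • star x := by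
  have h1 : Continuous fun x : p.Compl => star (r • x) := (continuous_const_smul r).star
  have h2 : Continuous fun x : p.Compl => star r • star x := continuous_star.const_smul (star r)
  refine p.compl_induction x (isClosed_eq h1 h2) fun x => ?_
  rw [star_toCompl, ← toCompl_smul, star_toCompl, star_smul, toCompl_smul]

theorem norm_mul_self_le_compl (x : p.Compl) : ‖x‖ * ‖x‖ ≤ ‖star x * x‖ := by
  have h1 : Continuous fun x : p.Compl => ‖x‖ * ‖x‖ := continuous_norm.mul continuous_norm
  have h2 : Continuous fun x : p.Compl => ‖star x * x‖ :=
    (continuous_star.mul continuous_id).norm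
  refine p.compl_induction x (isClosed_le h1 h2) fun x => ?_
  rw [star_toCompl, ← toCompl_mul, norm_toCompl, norm_toCompl, star_mul_self]

instance : CStarAlgebra p.Compl where
  norm_mul_self_le := p.norm_mul_self_le_compl
  star_smul := p.star_smul_compl

/-- The canonical `*`-homomorphism of `F` to its completion. -/
def toComplHom : F →⋆ₐ[ℂ] p.Compl where
  toFun := p.toCompl
  map_one' := p.toCompl_one
  map_mul' := p.toCompl_mul
  map_zero' := rfl
  map_add' := p.toCompl_add
  commutes' r := by
    rw [Algebra.algebraMap_eq_smul_one, toCompl_smul, toCompl_one,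
      Algebra.algebraMap_eq_smul_one]
  map_star' x := (p.star_toCompl x).symm

/-- A `*`-homomorphism of `F` to a `C*`-algebra which is bounded by `p` extends to the
completion. -/
def extend {B : Type v} [CStarAlgebra B] (π : F →⋆ₐ[ℂ] B) (hπ : ∀ x, ‖π x‖ ≤ p x) :
    p.Compl →⋆ₐ[ℂ] B :=
  have hc : Continuous (show p.Pre →+* B from π.toAlgHom.toRingHom) :=
    AddMonoidHomClass.continuous_of_bound (show p.Pre →+* B from π.toAlgHom.toRingHom) 1
      (fun x => (hπ x).trans_eq (one_mul _).symm)
  let g : p.Compl →+* B := UniformSpace.Completion.extensionHom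
    (show p.Pre →+* B from π.toAlgHom.toRingHom) hc
  have hg : Continuous g := UniformSpace.Completion.continuous_extension
  have hgc : ∀ x, g (p.toCompl x) = π x := fun x =>
    UniformSpace.Completion.extensionHom_coe (show p.Pre →+* B from π.toAlgHom.toRingHom) hc x
  { g with
    commutes' := fun r => by
      change g (algebraMap ℂ p.Compl r) = _
      rw [← (p.toComplHom).toAlgHom.commutes r]
      exact (hgc _).trans (π.toAlgHom.commutes r)
    map_star' := fun x => by
      change g (star x) = star (g x)
      refine p.compl_induction (P := fun x => g (star x) = star (g x)) x
        (isClosed_eq (by fun_prop) (by fun_prop)) fun x => ?_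
      rw [star_toCompl, hgc, hgc, map_star] }

theorem extend_toCompl {B : Type v} [CStarAlgebra B] (π : F →⋆ₐ[ℂ] B)
    (hπ : ∀ x, ‖π x‖ ≤ p x) (x : F) : p.extend π hπ (p.toComplHom x) = π x :=
  UniformSpace.Completion.extensionHom_coe (show p.Pre →+* B from π.toAlgHom.toRingHom)
    (AddMonoidHomClass.continuous_of_bound (show p.Pre →+* B from π.toAlgHom.toRingHom) 1
      (fun x => (hπ x).trans_eq (one_mul _).symm)) x

/-- The `C*`-seminorm defined by a `*`-homomorphism to a `C*`-algebra. -/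
def ofHom {B : Type v} [CStarAlgebra B] (π : F →⋆ₐ[ℂ] B) : CStarSeminorm F where
  toFun x := ‖π x‖
  map_zero' := by simp
  add_le' x y := by rw [map_add]; exact norm_add_le _ _
  neg' x := by rw [map_neg, norm_neg]
  smul' c x := by rw [map_smul, norm_smul]
  mul_le' x y := by rw [map_mul]; exact norm_mul_le _ _
  star_mul_self' x := by rw [map_mul, map_star, CStarRing.norm_star_mul_self]

end CStarSeminorm

/-- The pointwise supremum of a pointwise bounded set of `C*`-seminorms. -/
def CStarSeminorm.sup {F : Type u} [Ring F] [StarRing F] [Algebra ℂ F] [StarModule ℂ F]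
    (P : Set (CStarSeminorm F)) (hP : ∀ x, BddAbove (Set.range fun p : P => p.1 x)) :
    CStarSeminorm F where
  toFun x := ⨆ p : P, p.1 x
  map_zero' := by simp
  add_le' x y := by
    refine Real.iSup_le (fun p => (map_add_le_add p.1.toSeminorm x y).trans
      (add_le_add (le_ciSup (hP x) p) (le_ciSup (hP y) p))) ?_
    exact add_nonneg (Real.iSup_nonneg fun p => apply_nonneg p.1.toSeminorm _)
      (Real.iSup_nonneg fun p => apply_nonneg p.1.toSeminorm _)
  neg' x := by simp
  smul' c x := by
    simp only [map_smul_eq_mul]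
    exact (Real.mul_iSup_of_nonneg (norm_nonneg c) _).symm
  mul_le' x y := by
    have h0 : ∀ z : F, 0 ≤ ⨆ p : P, p.1 z := fun z =>
      Real.iSup_nonneg fun p => apply_nonneg p.1.toSeminorm _
    refine Real.iSup_le (fun p => (p.1.mul_le x y).trans
      (mul_le_mul (le_ciSup (hP x) p) (le_ciSup (hP y) p) (apply_nonneg p.1.toSeminorm _) (h0 x)))
      (mul_nonneg (h0 x) (h0 y))
  star_mul_self' x := by
    have h0 : ∀ z : F, 0 ≤ ⨆ p : P, p.1 z := fun z =>
      Real.iSup_nonneg fun p => apply_nonneg p.1.toSeminorm _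
    apply le_antisymm
    · refine Real.iSup_le (fun p => ?_) (mul_nonneg (h0 x) (h0 x))
      rw [star_mul_self]
      exact mul_le_mul (le_ciSup (hP x) p) (le_ciSup (hP x) p)
        (apply_nonneg p.1.toSeminorm _) (h0 x)
    · rw [← sq, ← Real.le_sqrt (h0 x) (h0 _)]
      refine Real.iSup_le (fun p => ?_) (Real.sqrt_nonneg _)
      rw [Real.le_sqrt (apply_nonneg p.1.toSeminorm _) (h0 _), sq, ← star_mul_self]
      exact le_ciSup (hP (star x * x)) p

/-! ### Quotients of `C*`-algebras by closed two-sided ideals -/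

section Quotient

variable {B : Type u} [CStarAlgebra B] (J : Ideal B) [J.IsTwoSided]

theorem exists_approx_unit {j : B} (hj : j ∈ J) {ε : ℝ} (hε : 0 < ε) :
    ∃ e ∈ J, IsSelfAdjoint e ∧ ‖1 - e‖ ≤ 1 ∧ ‖j * (1 - e)‖ ≤ ε := by
  set a := star j * j with ha
  have haJ : a ∈ J := J.mul_mem_left _ hj
  have hsa : IsSelfAdjoint a := IsSelfAdjoint.star_mul_self j
  have hsp : ∀ t ∈ spectrum ℝ a, 0 ≤ t := spectrum_star_mul_self_nonneg
  have hδ : 0 < ε ^ 2 := by positivity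
  set δ := ε ^ 2 with hδdef
  have hne : ∀ t ∈ spectrum ℝ a, t + δ ≠ 0 := fun t ht => by
    have := hsp t ht; positivity
  have hc : ContinuousOn (fun t : ℝ => (t + δ)⁻¹) (spectrum ℝ a) :=
    ContinuousOn.inv₀ (by fun_prop) hne
  set f := cfc (fun t : ℝ => δ * (t + δ)⁻¹) a with hf
  have hcf : ContinuousOn (fun t : ℝ => δ * (t + δ)⁻¹) (spectrum ℝ a) :=
    continuousOn_const.mul hc
  have hfe : f = 1 - a * cfc (fun t : ℝ => (t + δ)⁻¹) a := by
    have h1 : a * cfc (fun t : ℝ => (t + δ)⁻¹) a = cfc (fun t : ℝ => t * (t + δ)⁻¹) a := by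
      rw [cfc_mul (fun t : ℝ => t) (fun t : ℝ => (t + δ)⁻¹) a (by fun_prop) hc, cfc_id' ℝ a]
    rw [h1, ← cfc_one ℝ a, ← cfc_sub (1 : ℝ → ℝ) (fun t : ℝ => t * (t + δ)⁻¹) a
      (continuousOn_const) (continuousOn_id.mul hc)]
    refine cfc_congr fun t ht => ?_
    have := hne t ht
    simp only [Pi.one_apply]
    field_simp
    ring
  have hfs : IsSelfAdjoint f := cfc_predicate _ a
  have hfn : ‖f‖ ≤ 1 := by
    refine norm_cfc_le zero_le_one fun t ht => ?_
    have h0 := hsp t ht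
    rw [Real.norm_of_nonneg (by positivity), ← div_eq_mul_inv, div_le_one (by positivity)]
    linarith
  refine ⟨1 - f, ?_, (IsSelfAdjoint.one B).sub hfs, by simpa using hfn, ?_⟩
  · rw [hfe, sub_sub_cancel]
    exact J.mul_mem_right _ haJ
  · rw [sub_sub_cancel]
    have h2 : star (j * f) * (j * f) = cfc (fun t : ℝ => δ * (t + δ)⁻¹ * t * (δ * (t + δ)⁻¹)) a := by
      rw [star_mul, hfs.star_eq, cfc_mul (fun t : ℝ => δ * (t + δ)⁻¹ * t) _ a
        (hcf.mul continuousOn_id) hcf, cfc_mul _ (fun t : ℝ => t) a hcf continuousOn_id,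
        cfc_id' ℝ a]
      change f * star j * (j * f) = f * (star j * j) * f
      simp only [mul_assoc]
    have h3 : ‖j * f‖ * ‖j * f‖ ≤ δ := by
      rw [← CStarRing.norm_star_mul_self, h2]
      refine norm_cfc_le hδ.le fun t ht => ?_
      have h0 := hsp t ht
      have hp : 0 < t + δ := by positivity
      rw [Real.norm_of_nonneg (by positivity)]
      have e1 : t * (t + δ)⁻¹ ≤ 1 := by
        rw [← div_eq_mul_inv, div_le_one hp]; linarith
      have e2 : δ * (t + δ)⁻¹ ≤ 1 := by
        rw [← div_eq_mul_inv, div_le_one hp]; linarith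
      calc δ * (t + δ)⁻¹ * t * (δ * (t + δ)⁻¹)
          = δ * ((t * (t + δ)⁻¹) * (δ * (t + δ)⁻¹)) := by ring
        _ ≤ δ * 1 := by
          refine mul_le_mul_of_nonneg_left ?_ hδ.le
          exact mul_le_one₀ e1 (by positivity) e2
        _ = δ := mul_one _
    nlinarith [norm_nonneg (j * f)]

variable [hJ : IsClosed (J : Set B)]

theorem star_mem_ideal {j : B} (hj : j ∈ J) : star j ∈ J := by
  have : star j ∈ closure (J : Set B) := by
    refine Metric.mem_closure_iff.2 fun ε hε => ?_
    obtain ⟨e, he, hes, -, hn⟩ := exists_approx_unit J hj (half_pos hε)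
    refine ⟨e * star j, J.mul_mem_right _ he, ?_⟩
    rw [dist_eq_norm, ← norm_star, star_sub, star_star, star_mul, star_star, hes.star_eq]
    rw [mul_sub, mul_one] at hn
    linarith
  rwa [hJ.closure_eq] at this

instance : StarRing (B ⧸ J) where
  star := Quotient.map' star fun a b hab => by
    rw [Submodule.quotientRel_def] at hab ⊢
    rw [← star_sub]
    exact star_mem_ideal J hab
  star_involutive := by
    rintro ⟨a⟩; exact congrArg (Ideal.Quotient.mk J) (star_star a)
  star_mul := by
    rintro ⟨a⟩ ⟨b⟩; exact congrArg (Ideal.Quotient.mk J) (star_mul a b)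
  star_add := by
    rintro ⟨a⟩ ⟨b⟩; exact congrArg (Ideal.Quotient.mk J) (star_add a b)

theorem quotient_star_mk (a : B) :
    star (Ideal.Quotient.mk J a) = Ideal.Quotient.mk J (star a) := rfl

theorem quotient_norm_mk_le (a : B) : ‖Ideal.Quotient.mk J a‖ ≤ ‖a‖ :=
  Submodule.Quotient.norm_mk_le J a

theorem quotient_exists_norm_lt (x : B ⧸ J) {ε : ℝ} (hε : 0 < ε) :
    ∃ a : B, Ideal.Quotient.mk J a = x ∧ ‖a‖ < ‖x‖ + ε :=
  Submodule.Quotient.norm_mk_lt (S := J) x hε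

instance : NormedRing (B ⧸ J) where
  __ := (inferInstance : Ring (B ⧸ J))
  __ := (inferInstance : NormedAddCommGroup (B ⧸ J))
  norm_mul_le x y := by
    have key : ∀ ε > 0, ‖x * y‖ ≤ (‖x‖ + ε) * (‖y‖ + ε) := fun ε hε => by
      obtain ⟨a, rfl, ha⟩ := quotient_exists_norm_lt J x hε
      obtain ⟨b, rfl, hb⟩ := quotient_exists_norm_lt J y hε
      rw [← map_mul]
      exact (quotient_norm_mk_le J _).trans ((norm_mul_le a b).trans
        (mul_le_mul ha.le hb.le (norm_nonneg _) (by positivity)))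
    have hc : Filter.Tendsto (fun ε : ℝ => (‖x‖ + ε) * (‖y‖ + ε)) (nhdsWithin 0 (Set.Ioi 0))
        (nhds ((‖x‖ + 0) * (‖y‖ + 0))) :=
      (Continuous.tendsto (by fun_prop) 0).mono_left nhdsWithin_le_nhds
    rw [add_zero, add_zero] at hc
    exact ge_of_tendsto hc (Filter.eventually_of_mem self_mem_nhdsWithin key)

instance : CStarAlgebra (B ⧸ J) where
  __ := (inferInstance : NormedRing (B ⧸ J))
  __ := (inferInstance : StarRing (B ⧸ J))
  __ := (inferInstance : CompleteSpace (B ⧸ J))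
  __ := (inferInstance : Algebra ℂ (B ⧸ J))
  norm_smul_le := norm_smul_le
  star_smul := by
    rintro r ⟨a⟩; exact congrArg (Ideal.Quotient.mk J) (star_smul r a)
  norm_mul_self_le x := by
    refine le_of_forall_pos_le_add fun ε hε => ?_
    obtain ⟨a, rfl⟩ := Ideal.Quotient.mk_surjective x
    obtain ⟨b, hb, hbn⟩ := quotient_exists_norm_lt J
      (star (Ideal.Quotient.mk J a) * Ideal.Quotient.mk J a) (half_pos hε)
    have hj : b - star a * a ∈ J := by
      rw [← Ideal.Quotient.eq_zero_iff_mem, map_sub, hb, map_mul, quotient_star_mk, sub_self]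
    set j := b - star a * a with hjd
    obtain ⟨e, he, hes, hn, hje⟩ := exists_approx_unit J hj (half_pos hε)
    have h1 : Ideal.Quotient.mk J a = Ideal.Quotient.mk J (a * (1 - e)) := by
      rw [Ideal.Quotient.eq, mul_sub, mul_one, sub_sub_cancel]
      exact J.mul_mem_left _ he
    have hfs : star (1 - e) = 1 - e := by rw [star_sub, star_one, hes.star_eq]
    set f := 1 - e with hf
    have h2 : ‖a * f‖ * ‖a * f‖ ≤ ‖b‖ + ε / 2 := by
      have e1 : star (a * f) * (a * f) = f * b * f - f * (j * f) := by
        rw [star_mul, hfs, hjd]; noncomm_ring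
      rw [← CStarRing.norm_star_mul_self, e1]
      refine (norm_sub_le _ _).trans (add_le_add ?_ ?_)
      · calc ‖f * b * f‖ ≤ ‖f‖ * ‖b‖ * ‖f‖ :=
              (norm_mul_le _ _).trans (mul_le_mul_of_nonneg_right (norm_mul_le _ _) (norm_nonneg _))
          _ ≤ 1 * ‖b‖ * 1 := by gcongr
          _ = ‖b‖ := by ring
      · calc ‖f * (j * f)‖ ≤ ‖f‖ * ‖j * f‖ := norm_mul_le _ _
          _ ≤ 1 * (ε / 2) := by gcongr
          _ = ε / 2 := one_mul _
    have h3 := quotient_norm_mk_le J (a * f)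
    rw [h1] at hbn ⊢
    nlinarith [norm_nonneg (Ideal.Quotient.mk J (a * f)), norm_nonneg (a * f)]

end Quotient

theorem continuous_starAlgHom {B : Type u} {C : Type v} [CStarAlgebra B] [CStarAlgebra C]
    (f : B →⋆ₐ[ℂ] C) : Continuous f :=
  AddMonoidHomClass.continuous_of_bound f 1
    fun x => (NonUnitalStarAlgHom.norm_apply_le f x).trans_eq (one_mul _).symm

/-! ### The Toeplitz algebra -/

section Toeplitz

variable {A : Type u} [CStarAlgebra A] (α : A →⋆ₐ[ℂ] A) (L : A →ₗ[ℂ] A)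

/-- The elements of the free `*`-algebra on the symbols `some a` (`a ∈ A`) and `none` (for `S`)
which have to vanish in the Toeplitz algebra: those which express that `a ↦ some a` is a unital
`*`-homomorphism, that `S a = α(a) S`, and that `S* a S = L(a)`. -/
inductive ToeplitzRel : FreeStar (Option A) → Prop
  | one : ToeplitzRel (.of (some 1) - 1)
  | add (a b : A) : ToeplitzRel (.of (some (a + b)) - (.of (some a) + .of (some b)))
  | smul (c : ℂ) (a : A) : ToeplitzRel (.of (some (c • a)) - c • .of (some a))
  | mul (a b : A) : ToeplitzRel (.of (some (a * b)) - .of (some a) * .of (some b))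
  | star (a : A) : ToeplitzRel (.of (some (star a)) - star (.of (some a)))
  | comm (a : A) : ToeplitzRel (.of none * .of (some a) - .of (some (α a)) * .of none)
  | transfer (a : A) :
      ToeplitzRel (star (.of none) * .of (some a) * .of none - .of (some (L a)))

/-- A covariant pair in a unital `C*`-algebra `B`: a unital `*`-homomorphism `ρ : A → B` and an
element `s` of `B` which satisfy the two defining relations of the Toeplitz algebra. -/
structure IsToeplitzPair {B : Type v} [CStarAlgebra B] (ρ : A →⋆ₐ[ℂ] B) (s : B) : Prop where
  comm : ∀ a, s * ρ a = ρ (α a) * s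
  transfer : ∀ a, star s * ρ a * s = ρ (L a)

/-- The `C*`-seminorms on the free `*`-algebra which vanish on the relations. -/
def toeplitzSeminorms : Set (CStarSeminorm (FreeStar (Option A))) :=
  {p | ∀ x, ToeplitzRel α L x → p x = 0}

variable {α L}

section

variable {p : CStarSeminorm (FreeStar (Option A))}

theorem toComplHom_eq_of_sub (hp : p ∈ toeplitzSeminorms α L) {x y : FreeStar (Option A)}
    (h : ToeplitzRel α L (x - y)) : p.toComplHom x = p.toComplHom y := by
  rw [← sub_eq_zero, ← map_sub, ← norm_eq_zero]
  exact (p.norm_toCompl _).trans (hp _ h)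

/-- The `*`-homomorphism of `A` to the completion defined by an admissible seminorm. -/
def coeffHom (hp : p ∈ toeplitzSeminorms α L) : A →⋆ₐ[ℂ] p.Compl where
  toFun a := p.toComplHom (.of (some a))
  map_one' := (toComplHom_eq_of_sub hp .one).trans (map_one _)
  map_mul' a b := (toComplHom_eq_of_sub hp (.mul a b)).trans (map_mul _ _ _)
  map_add' a b := (toComplHom_eq_of_sub hp (.add a b)).trans (map_add _ _ _)
  map_zero' := by
    have h := toComplHom_eq_of_sub hp (.smul 0 0)
    rwa [zero_smul, zero_smul, map_zero] at h
  commutes' r := by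
    rw [Algebra.algebraMap_eq_smul_one, Algebra.algebraMap_eq_smul_one,
      toComplHom_eq_of_sub hp (.smul r 1), map_smul]
    exact congrArg (r • ·) ((toComplHom_eq_of_sub hp .one).trans (map_one _))
  map_star' a := (toComplHom_eq_of_sub hp (.star a)).trans (map_star _ _)

theorem isToeplitzPair_coeffHom (hp : p ∈ toeplitzSeminorms α L) :
    IsToeplitzPair α L (coeffHom hp) (p.toComplHom (.of none)) where
  comm a := by
    have h := toComplHom_eq_of_sub hp (.comm a)
    rwa [map_mul, map_mul] at h
  transfer a := by
    have h := toComplHom_eq_of_sub hp (.transfer a)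
    rwa [map_mul, map_mul, map_star] at h

theorem seminorm_of_some_le (hp : p ∈ toeplitzSeminorms α L) (a : A) :
    p (.of (some a)) ≤ ‖a‖ :=
  (p.norm_toCompl _).symm.trans_le (NonUnitalStarAlgHom.norm_apply_le (coeffHom hp) a)

theorem seminorm_of_none_le (hp : p ∈ toeplitzSeminorms α L) :
    p (.of none) ≤ Real.sqrt ‖L 1‖ := by
  refine Real.le_sqrt_of_sq_le ?_
  have h := (isToeplitzPair_coeffHom hp).transfer 1
  rw [map_one, mul_one] at h
  have h2 := CStarRing.norm_star_mul_self (x := p.toComplHom (.of none))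
  have h3 : ‖p.toComplHom (.of none)‖ = p (.of none) := p.norm_toCompl _
  rw [h, h3] at h2
  rw [sq, ← h2]
  exact NonUnitalStarAlgHom.norm_apply_le (coeffHom hp) (L 1)

end

variable (α L)

theorem toeplitzSeminorms_bddAbove (x : FreeStar (Option A)) :
    BddAbove (Set.range fun p : toeplitzSeminorms α L => p.1 x) := by
  suffices h : ∃ C, 0 ≤ C ∧ ∀ p ∈ toeplitzSeminorms α L, p x ≤ C by
    obtain ⟨C, -, hC⟩ := h
    exact ⟨C, by rintro _ ⟨p, rfl⟩; exact hC p.1 p.2⟩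
  have hg : ∀ x : Option A, ∃ C, 0 ≤ C ∧ ∀ p ∈ toeplitzSeminorms α L, p (.of x) ≤ C := by
    rintro (_ | a)
    · exact ⟨_, Real.sqrt_nonneg _, fun p hp => seminorm_of_none_le hp⟩
    · exact ⟨_, norm_nonneg a, fun p hp => seminorm_of_some_le hp a⟩
  induction x using FreeStar.induction with
  | h0 r =>
    refine ⟨‖r‖, norm_nonneg r, fun p _ => ?_⟩
    have h1 : p 1 ≤ 1 := by
      have h := p.star_mul_self 1
      rw [star_one, one_mul] at h
      nlinarith [apply_nonneg p.toSeminorm 1]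
    rw [Algebra.algebraMap_eq_smul_one, map_smul_eq_mul]
    exact mul_le_of_le_one_right (norm_nonneg r) h1
  | h1 x => exact hg x
  | h2 x =>
    obtain ⟨C, h0, hC⟩ := hg x
    exact ⟨C, h0, fun p hp => by rw [← FreeStar.star_of, p.star_eq]; exact hC p hp⟩
  | hm a b ha hb =>
    obtain ⟨C, h0, hC⟩ := ha
    obtain ⟨D, h0', hD⟩ := hb
    exact ⟨C * D, mul_nonneg h0 h0', fun p hp => (p.mul_le a b).trans
      (mul_le_mul (hC p hp) (hD p hp) (apply_nonneg p.toSeminorm _) h0)⟩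
  | ha a b ha hb =>
    obtain ⟨C, h0, hC⟩ := ha
    obtain ⟨D, h0', hD⟩ := hb
    exact ⟨C + D, add_nonneg h0 h0', fun p hp => (map_add_le_add p.toSeminorm a b).trans
      (add_le_add (hC p hp) (hD p hp))⟩

/-- The largest `C*`-seminorm on the free `*`-algebra which vanishes on the relations. -/
def toeplitzSeminorm : CStarSeminorm (FreeStar (Option A)) :=
  CStarSeminorm.sup (toeplitzSeminorms α L) (toeplitzSeminorms_bddAbove α L)

theorem toeplitzSeminorm_mem : toeplitzSeminorm α L ∈ toeplitzSeminorms α L := fun x hx =>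
  le_antisymm (Real.iSup_le (fun p => (p.2 x hx).le) le_rfl)
    (apply_nonneg (toeplitzSeminorm α L).toSeminorm x)

/-- The Toeplitz algebra `T(A, α, L)`: the universal unital `C*`-algebra generated by a copy of
`A` and an element `S`, subject to the relations `S a = α(a) S` and `S* a S = L(a)`. -/
def Toeplitz : Type u := (toeplitzSeminorm α L).Compl

namespace Toeplitz

instance : CStarAlgebra (Toeplitz α L) :=
  inferInstanceAs (CStarAlgebra (toeplitzSeminorm α L).Compl)

/-- The canonical map of `A` to the Toeplitz algebra. -/
def ι : A →⋆ₐ[ℂ] Toeplitz α L := coeffHom (toeplitzSeminorm_mem α L)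

/-- The canonical element `S` of the Toeplitz algebra. -/
def S : Toeplitz α L := (toeplitzSeminorm α L).toComplHom (.of none)

theorem isToeplitzPair : IsToeplitzPair α L (ι α L) (S α L) :=
  isToeplitzPair_coeffHom (toeplitzSeminorm_mem α L)

variable {α L}

theorem lift_aux {B : Type v} [CStarAlgebra B] {ρ : A →⋆ₐ[ℂ] B} {s : B}
    (h : IsToeplitzPair α L ρ s) (x : FreeStar (Option A)) :
    ‖FreeStar.lift (fun o : Option A => o.elim s ρ) x‖ ≤ toeplitzSeminorm α L x := by
  set π := FreeStar.lift (fun o : Option A => o.elim s ρ)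
  have h1 : ∀ a, π (.of (some a)) = ρ a := fun a => FreeStar.lift_of _ _
  have h2 : π (.of none) = s := FreeStar.lift_of _ _
  have hmem : CStarSeminorm.ofHom π ∈ toeplitzSeminorms α L := fun x hx => by
    suffices π x = 0 from norm_eq_zero.2 this
    cases hx with
    | one => rw [map_sub, h1, map_one, map_one, sub_self]
    | add a b => rw [map_sub, map_add, h1, h1, h1, map_add, sub_self]
    | smul c a => rw [map_sub, map_smul, h1, h1, map_smul, sub_self]
    | mul a b => rw [map_sub, map_mul, h1, h1, h1, map_mul, sub_self]
    | star a => rw [map_sub, map_star, h1, h1, map_star, sub_self]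
    | comm a => rw [map_sub, map_mul, map_mul, h1, h1, h2, h.comm, sub_self]
    | transfer a => rw [map_sub, map_mul, map_mul, map_star, h1, h1, h2, h.transfer, sub_self]
  exact le_ciSup (toeplitzSeminorms_bddAbove α L x) ⟨_, hmem⟩

/-- The universal property of the Toeplitz algebra: existence. -/
def lift {B : Type v} [CStarAlgebra B] {ρ : A →⋆ₐ[ℂ] B} {s : B}
    (h : IsToeplitzPair α L ρ s) : Toeplitz α L →⋆ₐ[ℂ] B :=
  (toeplitzSeminorm α L).extend (FreeStar.lift (fun o : Option A => o.elim s ρ)) (lift_aux h)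

theorem lift_ι {B : Type v} [CStarAlgebra B] {ρ : A →⋆ₐ[ℂ] B} {s : B}
    (h : IsToeplitzPair α L ρ s) (a : A) : lift h (ι α L a) = ρ a :=
  (CStarSeminorm.extend_toCompl _ _ (lift_aux h) _).trans (FreeStar.lift_of _ _)

theorem lift_S {B : Type v} [CStarAlgebra B] {ρ : A →⋆ₐ[ℂ] B} {s : B}
    (h : IsToeplitzPair α L ρ s) : lift h (S α L) = s :=
  (CStarSeminorm.extend_toCompl _ _ (lift_aux h) _).trans (FreeStar.lift_of _ _)

/-- The universal property of the Toeplitz algebra: uniqueness. -/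
theorem hom_ext {B : Type v} [CStarAlgebra B] {f g : Toeplitz α L →⋆ₐ[ℂ] B}
    (hι : ∀ a, f (ι α L a) = g (ι α L a)) (hS : f (S α L) = g (S α L)) : f = g := by
  have key : ∀ x : FreeStar (Option A), f ((toeplitzSeminorm α L).toComplHom x) =
      g ((toeplitzSeminorm α L).toComplHom x) := fun x => by
    let f' := f.comp (toeplitzSeminorm α L).toComplHom
    let g' := g.comp (toeplitzSeminorm α L).toComplHom
    change f' x = g' x
    have hof : ∀ o : Option A, f' (.of o) = g' (.of o) := by
      rintro (_ | a)
      exacts [hS, hι a]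
    induction x using FreeStar.induction with
    | h0 r => exact (f'.toAlgHom.commutes r).trans (g'.toAlgHom.commutes r).symm
    | h1 x => exact hof x
    | h2 x => rw [← FreeStar.star_of, map_star, map_star, hof]
    | hm a b ha hb => rw [map_mul, map_mul, ha, hb]
    | ha a b ha hb => rw [map_add, map_add, ha, hb]
  have hf : Continuous f := continuous_starAlgHom f
  have hg : Continuous g := continuous_starAlgHom g
  refine DFunLike.ext _ _ fun x => ?_
  exact (toeplitzSeminorm α L).compl_induction x (isClosed_eq hf hg) key

variable (α L)

theorem isToeplitzPair_unitary {u : A} (hu : u ∈ unitary A) (hc : u ∈ Set.center A) :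
    IsToeplitzPair α L (ι α L) (ι α L u * S α L) where
  comm a := by
    rw [mul_assoc, (isToeplitzPair α L).comm, ← mul_assoc, ← mul_assoc, ← map_mul, ← map_mul,
      Set.mem_center_iff.1 hc |>.comm (α a)]
  transfer a := by
    have h1 : star u * a * u = a := by
      rw [mul_assoc, ← (Set.mem_center_iff.1 hc |>.comm a), ← mul_assoc,
        Unitary.star_mul_self_of_mem hu, one_mul]
    calc star (ι α L u * S α L) * ι α L a * (ι α L u * S α L)
        = star (S α L) * ι α L (star u * a * u) * S α L := by
          rw [star_mul, ← map_star, map_mul, map_mul]; simp only [mul_assoc]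
      _ = ι α L (L a) := by rw [h1, (isToeplitzPair α L).transfer]

/-- The `*`-endomorphism of the Toeplitz algebra which fixes `A` and maps `S` to `u S`. -/
def gaugeHom {u : A} (hu : u ∈ unitary A) (hc : u ∈ Set.center A) :
    Toeplitz α L →⋆ₐ[ℂ] Toeplitz α L :=
  lift (isToeplitzPair_unitary α L hu hc)

theorem gaugeHom_ι {u : A} (hu : u ∈ unitary A) (hc : u ∈ Set.center A) (a : A) :
    gaugeHom α L hu hc (ι α L a) = ι α L a := lift_ι _ a

theorem gaugeHom_S {u : A} (hu : u ∈ unitary A) (hc : u ∈ Set.center A) :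
    gaugeHom α L hu hc (S α L) = ι α L u * S α L := lift_S _

theorem gaugeHom_comp {u v : A} (hu : u ∈ unitary A) (hc : u ∈ Set.center A)
    (hv : v ∈ unitary A) (hd : v ∈ Set.center A) (huv : v * u = 1) :
    (gaugeHom α L hu hc).comp (gaugeHom α L hv hd) = StarAlgHom.id ℂ (Toeplitz α L) := by
  refine hom_ext (fun a => ?_) ?_
  · rw [StarAlgHom.comp_apply, gaugeHom_ι, gaugeHom_ι]; rfl
  · rw [StarAlgHom.comp_apply, gaugeHom_S, map_mul, gaugeHom_ι, gaugeHom_S, ← mul_assoc,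
      ← map_mul, huv, map_one, one_mul]; rfl

/-- The automorphism of the Toeplitz algebra which fixes `A` and maps `S` to `u S`, where `u` is
a unitary in the center of `A`. -/
def gaugeAut {u : A} (hu : u ∈ unitary A) (hc : u ∈ Set.center A) :
    Toeplitz α L ≃⋆ₐ[ℂ] Toeplitz α L :=
  StarAlgEquiv.ofStarAlgHom (gaugeHom α L hu hc)
    (gaugeHom α L (Unitary.star_mem hu) (Set.star_mem_center hc))
    (gaugeHom_comp α L _ _ _ _ (Unitary.mul_star_self_of_mem hu))
    (gaugeHom_comp α L _ _ _ _ (Unitary.star_mul_self_of_mem hu))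

end Toeplitz

/-! ### The crossed product -/

open Toeplitz

/-- The closed linear span of `A S S* A` in the Toeplitz algebra. -/
def redundancyModule : Submodule ℂ (Toeplitz α L) :=
  (Submodule.span ℂ {x | ∃ a b : A, x = ι α L a * S α L * star (S α L) * ι α L b}).topologicalClosure

/-- Redundancies: pairs `(a, k)` with `a` in `A` and `k` in the closed linear span of `A S S* A`
such that `a b S = k b S` for all `b` in `A`. -/
def IsRedundancy (a : A) (k : Toeplitz α L) : Prop :=
  k ∈ redundancyModule α L ∧ ∀ b : A, ι α L a * ι α L b * S α L = k * ι α L b * S α L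

/-- The closed two-sided ideal generated by the differences `a - k`, for all redundancies
`(a, k)`. -/
def redundancyIdeal : Ideal (Toeplitz α L) :=
  sInf {I | I.IsTwoSided ∧ IsClosed (I : Set (Toeplitz α L)) ∧
    ∀ a k, IsRedundancy α L a k → ι α L a - k ∈ I}

instance : (redundancyIdeal α L).IsTwoSided where
  mul_mem_of_left {x} y hx := by
    rw [redundancyIdeal, Submodule.mem_sInf] at hx ⊢
    intro I hI
    have := hI.1
    exact Ideal.mul_mem_right (I := I) y (hx I hI)

instance : IsClosed (redundancyIdeal α L : Set (Toeplitz α L)) := by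
  rw [redundancyIdeal, Submodule.coe_sInf]
  exact isClosed_biInter fun I hI => hI.2.1

/-- The crossed product of `A` by `α` relative to `L`. -/
abbrev CrossedProduct : Type u := Toeplitz α L ⧸ redundancyIdeal α L

namespace CrossedProduct

/-- The canonical quotient map. -/
def q : Toeplitz α L →⋆ₐ[ℂ] CrossedProduct α L where
  toRingHom := Ideal.Quotient.mk (redundancyIdeal α L)
  commutes' _ := rfl
  map_star' _ := rfl

theorem gaugeHom_mem {u : A} (hu : u ∈ unitary A) (hc : u ∈ Set.center A) {x : Toeplitz α L}
    (hx : x ∈ redundancyIdeal α L) : gaugeHom α L hu hc x ∈ redundancyIdeal α L := by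
  set σ := gaugeHom α L hu hc with hσ
  have hσc : Continuous σ := continuous_starAlgHom σ
  suffices h : redundancyIdeal α L ≤ (redundancyIdeal α L).comap σ from h hx
  refine sInf_le ⟨inferInstance, ?_, fun a k hak => ?_⟩
  · exact (inferInstance : IsClosed (redundancyIdeal α L : Set (Toeplitz α L))).preimage hσc
  · have hred : IsRedundancy α L a (σ k) := by
      refine ⟨?_, fun b => ?_⟩
      · have hk := hak.1
        have hle : (Submodule.span ℂ
            {x | ∃ a b : A, x = ι α L a * S α L * star (S α L) * ι α L b}) ≤
            (redundancyModule α L).comap σ.toAlgHom.toLinearMap := by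
          rw [Submodule.span_le]
          rintro _ ⟨a, b, rfl⟩
          refine Submodule.le_topologicalClosure _ (Submodule.subset_span
            ⟨a * u, star u * b, ?_⟩)
          change σ _ = _
          rw [map_mul, map_mul, map_mul, map_star, hσ, gaugeHom_ι, gaugeHom_ι, gaugeHom_S, map_mul,
            map_mul, star_mul, ← map_star]
          simp only [mul_assoc]
        have := Submodule.topologicalClosure_minimal _ hle
          ((Submodule.isClosed_topologicalClosure _).preimage hσc)
        exact this hk
      · have h2 : ι α L b * S α L = σ (ι α L (b * star u) * S α L) := by
          rw [map_mul, hσ, gaugeHom_ι, gaugeHom_S, ← mul_assoc, ← map_mul, mul_assoc b,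
            Unitary.star_mul_self_of_mem hu, mul_one]
        have ha : σ (ι α L a) = ι α L a := gaugeHom_ι α L hu hc a
        have h1 := hak.2 (b * star u)
        rw [mul_assoc, mul_assoc] at h1
        have h3 := congrArg σ h1
        rw [map_mul σ (ι α L a), map_mul σ k, ha] at h3
        rw [mul_assoc, mul_assoc, h2]
        exact h3
    have : σ (ι α L a - k) = ι α L a - σ k := by
      rw [map_sub]; exact congrArg (· - σ k) (gaugeHom_ι α L hu hc a)
    rw [Ideal.mem_comap, this]
    rw [redundancyIdeal, Submodule.mem_sInf]
    exact fun I hI => hI.2.2 a _ hred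

/-- The `*`-endomorphism of the crossed product induced by `gaugeHom`. -/
def gaugeHom {u : A} (hu : u ∈ unitary A) (hc : u ∈ Set.center A) :
    CrossedProduct α L →⋆ₐ[ℂ] CrossedProduct α L where
  toRingHom := Ideal.Quotient.lift (redundancyIdeal α L)
    ((q α L).comp (Toeplitz.gaugeHom α L hu hc)).toAlgHom.toRingHom
    (fun _ hx => Ideal.Quotient.eq_zero_iff_mem.2 (gaugeHom_mem α L hu hc hx))
  commutes' r := ((q α L).comp (Toeplitz.gaugeHom α L hu hc)).toAlgHom.commutes r
  map_star' := by
    rintro ⟨x⟩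
    exact map_star ((q α L).comp (Toeplitz.gaugeHom α L hu hc)) x

theorem gaugeHom_q {u : A} (hu : u ∈ unitary A) (hc : u ∈ Set.center A) (x : Toeplitz α L) :
    gaugeHom α L hu hc (q α L x) = q α L (Toeplitz.gaugeHom α L hu hc x) := rfl

theorem gaugeHom_comp {u v : A} (hu : u ∈ unitary A) (hc : u ∈ Set.center A)
    (hv : v ∈ unitary A) (hd : v ∈ Set.center A) (huv : v * u = 1) :
    (gaugeHom α L hu hc).comp (gaugeHom α L hv hd) = StarAlgHom.id ℂ (CrossedProduct α L) := by
  refine DFunLike.ext _ _ fun x => ?_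
  obtain ⟨x, rfl⟩ := Ideal.Quotient.mk_surjective x
  exact congrArg (q α L) (DFunLike.congr_fun (Toeplitz.gaugeHom_comp α L hu hc hv hd huv) x)

/-- The automorphism of the crossed product obtained from `Toeplitz.gaugeAut` by passage to the
quotient. -/
def gaugeAut {u : A} (hu : u ∈ unitary A) (hc : u ∈ Set.center A) :
    CrossedProduct α L ≃⋆ₐ[ℂ] CrossedProduct α L :=
  StarAlgEquiv.ofStarAlgHom (gaugeHom α L hu hc)
    (gaugeHom α L (Unitary.star_mem hu) (Set.star_mem_center hc))
    (gaugeHom_comp α L _ _ _ _ (Unitary.mul_star_self_of_mem hu))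
    (gaugeHom_comp α L _ _ _ _ (Unitary.star_mul_self_of_mem hu))

end CrossedProduct

/-! ### The gauge action of a central element -/

/-- The unitary `h ^ (i t) = exp (i t log h)`, for `h` positive and invertible. -/
def imPow (h : A) (t : ℝ) : A :=
  (selfAdjoint.expUnitary (t • ⟨CFC.log h, IsSelfAdjoint.log⟩) : unitary A)

theorem imPow_mem_unitary (h : A) (t : ℝ) : imPow h t ∈ unitary A := Subtype.prop _

theorem imPow_mem_center {h : A} (hh : h ∈ Set.center A) (t : ℝ) :
    imPow h t ∈ Set.center A := by
  rw [Semigroup.mem_center_iff]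
  intro b
  have h1 : Commute h b := (Set.mem_center_iff.1 hh).comm b
  have h2 : Commute (CFC.log h) b := h1.cfc_real Real.log
  have h3 : Commute (Complex.I • t • CFC.log h) b := (h2.smul_left t).smul_left _
  exact h3.exp_left.symm

/-- The gauge action on the Toeplitz algebra associated with `h`: `σ_t(S) = h ^ (i t) S` and
`σ_t(a) = a`. -/
def Toeplitz.gauge {h : A} (hh : h ∈ Set.center A) (t : ℝ) :
    Toeplitz α L ≃⋆ₐ[ℂ] Toeplitz α L :=
  Toeplitz.gaugeAut α L (imPow_mem_unitary h t) (imPow_mem_center hh t)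

/-- The gauge action on the crossed product associated with `h`. -/
def CrossedProduct.gauge {h : A} (hh : h ∈ Set.center A) (t : ℝ) :
    CrossedProduct α L ≃⋆ₐ[ℂ] CrossedProduct α L :=
  CrossedProduct.gaugeAut α L (imPow_mem_unitary h t) (imPow_mem_center hh t)

end Toeplitz

/-! ### Conditional expectations and transfer operators -/

/-- A conditional expectation of `A` onto the `*`-subalgebra `R`: a positive linear map which
restricts to the identity of `R` and is `R`-bilinear. -/
structure IsConditionalExpectation {A : Type u} [CStarAlgebra A] [PartialOrder A]
    [StarOrderedRing A] {R : StarSubalgebra ℂ A} (E : A →ₗ[ℂ] R) : Prop where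
  map_coe : ∀ r : R, E r = r
  map_nonneg : ∀ a : A, 0 ≤ a → 0 ≤ (E a : A)
  map_coe_mul : ∀ (r : R) (a : A), E (r * a) = r * E a
  map_mul_coe : ∀ (a : A) (r : R), E (a * r) = E a * r

/-- The transfer operator `α⁻¹ ∘ E`. -/
def transferOperator {A : Type u} [CStarAlgebra A] (α : A →⋆ₐ[ℂ] A)
    (hα : Function.Injective α) (E : A →ₗ[ℂ] α.range) : A →ₗ[ℂ] A where
  toFun a := (StarAlgEquiv.ofInjective α hα).symm (E a)
  map_add' a b := by rw [map_add, map_add]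
  map_smul' c a := by rw [map_smul, map_smul, RingHom.id_apply]

/-! ### KMS states -/

section KMS

variable {B : Type u} [CStarAlgebra B]

open scoped ComplexOrder in
/-- States of a unital `C*`-algebra: linear functionals which are positive and unital. -/
structure IsState (ψ : B →ₗ[ℂ] ℂ) : Prop where
  map_star_mul_self_nonneg : ∀ x, 0 ≤ ψ (star x * x)
  map_one : ψ 1 = 1

/-- `f` is the entire extension `z ↦ σ_z(y)` of `t ↦ σ_t(y)`. -/
structure IsEntireExtension (σ : ℝ → B ≃⋆ₐ[ℂ] B) (y : B) (f : ℂ → B) : Prop where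
  differentiable : Differentiable ℂ f
  apply_ofReal : ∀ t : ℝ, f t = σ t y

/-- `y` is analytic for `σ`. -/
def IsAnalyticElement (σ : ℝ → B ≃⋆ₐ[ℂ] B) (y : B) : Prop :=
  ∃ f : ℂ → B, IsEntireExtension σ y f

/-- `KMS_β` states: states `ψ` with `ψ(x σ_{iβ}(y)) = ψ(y x)` for all analytic elements `x` and
`y`. -/
structure IsKMSState (σ : ℝ → B ≃⋆ₐ[ℂ] B) (β : ℝ) (ψ : B →ₗ[ℂ] ℂ) : Prop where
  isState : IsState ψ
  kms : ∀ (x y : B) (f : ℂ → B), IsAnalyticElement σ x → IsEntireExtension σ y f →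
    ψ (x * f (Complex.I * β)) = ψ (y * x)

end KMS

end ExelCP

end

open ExelCP

/-!
The argument takes place in any `C*`-algebra `B` which contains a covariant pair `(ρ, s)` (that is,
`s ρ(a) = ρ(α a) s` and `s* ρ(a) s = ρ(L a)`) and carries an action `σ` with `σ_t(ρ a) = ρ a` and
`σ_t(s) = ρ(h ^ (i t)) s`; both the Toeplitz algebra and the crossed product are of this kind.

The function `z ↦ (ρ(h ^ (i z)) s) ^ n` is the entire extension of `t ↦ σ_t(s ^ n)`. Its value at
`i β` is `ρ(G) s ^ n`, where `G = g α(g) ⋯ α ^ (n - 1)(g)` and `g = h ^ (-β)`. Since `h ≥ c > 1`,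
the norm of `g` is less than `1`, and so is that of `G` if `n ≠ 0`. Two applications of the KMS
condition, to the fixed element `ρ d` and to `s ^ n`, give
`ψ(ρ(d) s ^ n) = ψ(s ^ n ρ(d)) = ψ(ρ(d G) s ^ n)`, hence `ψ(ρ(d (1 - G)) s ^ n) = 0` for all `d`.
As `1 - G` is invertible, `ψ` vanishes on `ρ(A) s ^ n` (`IsKMSState.coeff_mul_pow_eq_zero`).

For `m < n` the KMS condition turns `ψ(ρ(a) s ^ n s* ^ m ρ(b))` into a value of `ψ` at
`s* ^ m ρ(d) s ^ n = ρ(L ^ m d) s ^ (n - m)`, which is zero. The case `n < m` follows by taking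
adjoints, since states are hermitian.
-/

namespace ExelCP

/-! ### Complex powers of an element bounded below -/

section Power

variable {A : Type u} [CStarAlgebra A]

/-- The entire function `z ↦ h ^ (i z) = exp (i z log h)` which extends `t ↦ imPow h t`. -/
noncomputable def complexImPow (h : A) (z : ℂ) : A :=
  NormedSpace.exp ((Complex.I * z) • CFC.log h)

theorem complexImPow_ofReal (h : A) (t : ℝ) : complexImPow h t = imPow h t := by
  rw [complexImPow, imPow, selfAdjoint.expUnitary_coe, mul_smul]
  congr 2

theorem differentiable_complexImPow (h : A) : Differentiable ℂ (complexImPow h) := by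
  have h1 : Differentiable ℂ (NormedSpace.exp : A → A) := fun x =>
    (NormedSpace.exp_analytic (𝕂 := ℂ) x).differentiableAt
  have h2 : Differentiable ℂ fun z : ℂ => (Complex.I * z) • CFC.log h := by fun_prop
  exact h1.comp h2

theorem star_imPow (h : A) (t : ℝ) : star (imPow h t) = complexImPow h (-t) := by
  have h1 : star (CFC.log h) = CFC.log h := (IsSelfAdjoint.log (a := h)).star_eq
  rw [← complexImPow_ofReal, complexImPow, NormedSpace.star_exp, complexImPow, star_smul, h1]
  congr 2
  simp

/-- The element `h ^ (-β)` is a strict contraction if `h ≥ c > 1` and `β > 0`. -/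
theorem norm_complexImPow_lt_one [PartialOrder A] [StarOrderedRing A] {h : A}
    (hsa : IsSelfAdjoint h) {c : ℝ} (hc : 1 < c) (hch : algebraMap ℝ A c ≤ h)
    {β : ℝ} (hβ : 0 < β) : ‖complexImPow h (Complex.I * β)‖ < 1 := by
  have hsp : ∀ x ∈ spectrum ℝ h, c ≤ x := (algebraMap_le_iff_le_spectrum (ha := hsa)).1 hch
  have hlog : ContinuousOn Real.log (spectrum ℝ h) :=
    Real.continuousOn_log.mono fun x hx => by
      have := hsp x hx
      simp only [Set.mem_compl_iff, Set.mem_singleton_iff]; linarith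
  have e1 : complexImPow h (Complex.I * β) = NormedSpace.exp ((-β) • CFC.log h) := by
    rw [complexImPow, ← mul_assoc, Complex.I_mul_I, neg_one_mul, ← Complex.ofReal_neg]
    congr 1
  have e2 : (-β) • CFC.log h = cfc (fun x => (-β) * Real.log x) h :=
    (cfc_const_mul (-β) Real.log h hlog).symm
  have e3 : NormedSpace.exp (cfc (fun x => (-β) * Real.log x) h) =
      cfc (fun x => Real.exp ((-β) * Real.log x)) h := by
    rw [← CFC.real_exp_eq_normedSpace_exp (cfc_predicate _ h),
      ← cfc_comp' Real.exp (fun x => (-β) * Real.log x) h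
        Real.continuous_exp.continuousOn (continuousOn_const.mul hlog)]
  have hlt : Real.exp ((-β) * Real.log c) < 1 := by
    rw [Real.exp_lt_one_iff]
    nlinarith [mul_pos hβ (Real.log_pos hc)]
  rw [e1, e2, e3]
  refine lt_of_le_of_lt (norm_cfc_le (Real.exp_pos _).le fun x hx => ?_) hlt
  have hx' := Real.log_le_log (by linarith) (hsp x hx)
  rw [Real.norm_of_nonneg (Real.exp_pos _).le, Real.exp_le_exp]
  nlinarith

end Power

/-! ### Words in a covariant pair -/

section Words

variable {A : Type u} [CStarAlgebra A] {α : A →⋆ₐ[ℂ] A} {L : A →ₗ[ℂ] A}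
  {B : Type v} [CStarAlgebra B] {ρ : A →⋆ₐ[ℂ] B} {s : B}

/-- The coefficient `g α(g) ⋯ α ^ (n - 1)(g)` of `(g S) ^ n = g α(g) ⋯ α ^ (n - 1)(g) S ^ n`. -/
def cocycle (α : A →⋆ₐ[ℂ] A) (g : A) : ℕ → A
  | 0 => 1
  | n + 1 => g * α (cocycle α g n)

theorem IsToeplitzPair.coeff_mul_pow (hp : IsToeplitzPair α L ρ s) (g : A) (n : ℕ) :
    (ρ g * s) ^ n = ρ (cocycle α g n) * s ^ n := by
  induction n with
  | zero => simp [cocycle]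
  | succ n ih =>
    rw [pow_succ', ih, cocycle, map_mul, pow_succ' s]
    calc ρ g * s * (ρ (cocycle α g n) * s ^ n)
        = ρ g * (s * ρ (cocycle α g n)) * s ^ n := by simp only [mul_assoc]
      _ = _ := by rw [hp.comm]; simp only [mul_assoc]

theorem norm_cocycle_succ_lt_one {g : A} (hg : ‖g‖ < 1) (n : ℕ) :
    ‖cocycle α g (n + 1)‖ < 1 := by
  have hα : ∀ x, ‖α x‖ ≤ ‖x‖ := NonUnitalStarAlgHom.norm_apply_le α
  induction n with
  | zero => simpa [cocycle] using hg
  | succ n ih =>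
    rw [cocycle]
    calc _ ≤ ‖g‖ * ‖cocycle α g (n + 1)‖ :=
          (norm_mul_le _ _).trans (mul_le_mul_of_nonneg_left (hα _) (norm_nonneg _))
      _ < 1 := mul_lt_one_of_nonneg_of_lt_one_left (norm_nonneg _) hg ih.le

theorem IsToeplitzPair.transfer_pow (hp : IsToeplitzPair α L ρ s) (m : ℕ) (a : A) :
    star s ^ m * ρ a * s ^ m = ρ ((L ^ m) a) := by
  induction m generalizing a with
  | zero => simp
  | succ m ih =>
    calc star s ^ (m + 1) * ρ a * s ^ (m + 1)
        = star s ^ m * (star s * ρ a * s) * s ^ m := by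
          rw [pow_succ, pow_succ' s]; simp only [mul_assoc]
      _ = _ := by rw [hp.transfer, ih, pow_succ]; rfl

end Words

/-! ### KMS states -/

section KMS

variable {B : Type u} [CStarAlgebra B]

open scoped ComplexOrder in
/-- States are hermitian: this is positivity at `x + 1` and at `x + i`. -/
theorem IsState.map_star {ψ : B →ₗ[ℂ] ℂ} (hψ : IsState ψ) (x : B) :
    ψ (star x) = star (ψ x) := by
  have hpos : ∀ y, (ψ (star y * y)).im = 0 := fun y =>
    (Complex.le_def.1 (hψ.map_star_mul_self_nonneg y)).2.symm
  have h0 := hpos x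
  have h1 := hpos (x + 1)
  have h2 := hpos (x + Complex.I • 1)
  simp only [star_add, star_one, star_smul, mul_add, add_mul, mul_one, one_mul, smul_mul_assoc,
    mul_smul_comm, map_add, map_smul, hψ.map_one, smul_eq_mul, Complex.add_im, Complex.star_def,
    Complex.conj_I, Complex.mul_im, Complex.neg_re, Complex.neg_im, Complex.I_re, Complex.I_im,
    Complex.one_im, h0] at h1 h2
  apply Complex.ext
  · rw [Complex.star_def, Complex.conj_re]; linarith
  · rw [Complex.star_def, Complex.conj_im]; linarith

variable {A : Type v} [CStarAlgebra A] {α : A →⋆ₐ[ℂ] A} {L : A →ₗ[ℂ] A}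
  {ρ : A →⋆ₐ[ℂ] B} {s : B} {h : A} {σ : ℝ → B ≃⋆ₐ[ℂ] B}

theorem isEntireExtension_const {y : B} (hy : ∀ t, σ t y = y) :
    IsEntireExtension σ y fun _ => y :=
  ⟨differentiable_const y, fun t => (hy t).symm⟩

theorem differentiable_map_complexImPow (ρ : A →⋆ₐ[ℂ] B) (h : A) :
    Differentiable ℂ fun z => ρ (complexImPow h z) :=
  let ρ' : A →L[ℂ] B := ⟨ρ.toAlgHom.toLinearMap, continuous_starAlgHom ρ⟩
  ρ'.differentiable.comp (differentiable_complexImPow h)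

theorem isEntireExtension_coeff_mul_pow (hρ : ∀ t a, σ t (ρ a) = ρ a)
    (hs : ∀ t, σ t s = ρ (imPow h t) * s) (a : A) (n : ℕ) :
    IsEntireExtension σ (ρ a * s ^ n) fun z => ρ a * (ρ (complexImPow h z) * s) ^ n where
  differentiable := by
    exact (((differentiable_map_complexImPow ρ h).mul_const s).pow n).const_mul (ρ a)
  apply_ofReal t := by rw [map_mul, map_pow, hρ, hs, complexImPow_ofReal]

theorem isAnalyticElement_star_pow (hs : ∀ t, σ t s = ρ (imPow h t) * s) (m : ℕ) :
    IsAnalyticElement σ (star s ^ m) := by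
  refine ⟨fun z => (star s * ρ (complexImPow h (-z))) ^ m, ?_, fun t => ?_⟩
  · exact (((differentiable_map_complexImPow ρ h).comp differentiable_id.neg).const_mul
      (star s)).pow m
  · rw [map_pow, StarHomClass.map_star (σ t), hs, star_mul, ← StarHomClass.map_star ρ, star_imPow]

variable [PartialOrder A] [StarOrderedRing A] {c β : ℝ} {ψ : B →ₗ[ℂ] ℂ}

/-- A KMS state vanishes on `ρ(A) s ^ n` for `n ≠ 0`. -/
theorem IsKMSState.coeff_mul_pow_eq_zero (hψ : IsKMSState σ β ψ) (hp : IsToeplitzPair α L ρ s)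
    (hρ : ∀ t a, σ t (ρ a) = ρ a) (hs : ∀ t, σ t s = ρ (imPow h t) * s)
    (hsa : IsSelfAdjoint h) (hc : 1 < c) (hch : algebraMap ℝ A c ≤ h) (hβ : 0 < β)
    (a : A) {n : ℕ} (hn : n ≠ 0) : ψ (ρ a * s ^ n) = 0 := by
  obtain ⟨k, rfl⟩ := Nat.exists_eq_succ_of_ne_zero hn
  set G := cocycle α (complexImPow h (Complex.I * β)) (k + 1) with hG
  have hlt : ‖G‖ < 1 := norm_cocycle_succ_lt_one (norm_complexImPow_lt_one hsa hc hch hβ) k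
  have hentire := isEntireExtension_coeff_mul_pow hρ hs 1 (k + 1)
  rw [map_one, one_mul] at hentire
  have key : ∀ d, ψ (ρ (d * G) * s ^ (k + 1)) = ψ (ρ d * s ^ (k + 1)) := fun d => by
    have hd := isEntireExtension_const (hρ · d)
    have h1 := hψ.kms (ρ d) _ _ ⟨_, hd⟩ hentire
    have h2 := hψ.kms _ (ρ d) _ ⟨_, hentire⟩ hd
    rw [one_mul, hp.coeff_mul_pow, ← hG, ← mul_assoc, ← map_mul] at h1
    rw [h1, h2]
  obtain ⟨v, hv⟩ := isUnit_one_sub_of_norm_lt_one hlt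
  have ha : a = a * ↑v⁻¹ - a * ↑v⁻¹ * G := by
    rw [← mul_one_sub, ← hv, Units.inv_mul_cancel_right]
  rw [ha, map_sub, sub_mul, map_sub, key, sub_self]

theorem IsKMSState.word_eq_zero_of_lt (hψ : IsKMSState σ β ψ) (hp : IsToeplitzPair α L ρ s)
    (hρ : ∀ t a, σ t (ρ a) = ρ a) (hs : ∀ t, σ t s = ρ (imPow h t) * s)
    (hsa : IsSelfAdjoint h) (hc : 1 < c) (hch : algebraMap ℝ A c ≤ h) (hβ : 0 < β)
    (a b : A) {n m : ℕ} (hnm : m < n) : ψ (ρ a * s ^ n * star s ^ m * ρ b) = 0 := by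
  obtain ⟨k, rfl⟩ := Nat.exists_eq_add_of_lt hnm
  -- The word is a product `y * x` of analytic elements with `x = s* ^ m ρ(b)`.
  have hx : IsAnalyticElement σ (star s ^ m * ρ b) := by
    obtain ⟨f, hf⟩ := isAnalyticElement_star_pow hs m
    exact ⟨fun z => f z * ρ b, hf.differentiable.mul_const _,
      fun t => by rw [hf.apply_ofReal, map_mul, hρ]⟩
  have h1 := hψ.kms _ _ _ hx (isEntireExtension_coeff_mul_pow hρ hs a (m + k + 1))
  rw [mul_assoc (ρ a * _), ← h1, hp.coeff_mul_pow]
  set G := cocycle α (complexImPow h (Complex.I * β)) (m + k + 1)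
  have h2 : star s ^ m * ρ b * (ρ a * (ρ G * s ^ (m + k + 1))) =
      ρ ((L ^ m) (b * a * G)) * s ^ (k + 1) := by
    rw [← hp.transfer_pow, map_mul, map_mul, add_assoc, pow_add s m]
    simp only [mul_assoc]
  rw [h2]
  exact hψ.coeff_mul_pow_eq_zero hp hρ hs hsa hc hch hβ _ k.succ_ne_zero

/-- A KMS state vanishes on the words `ρ(a) s ^ n s* ^ m ρ(b)` of nonzero degree `n - m`. -/
theorem IsKMSState.word_eq_zero (hψ : IsKMSState σ β ψ) (hp : IsToeplitzPair α L ρ s)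
    (hρ : ∀ t a, σ t (ρ a) = ρ a) (hs : ∀ t, σ t s = ρ (imPow h t) * s)
    (hsa : IsSelfAdjoint h) (hc : 1 < c) (hch : algebraMap ℝ A c ≤ h) (hβ : 0 < β)
    (a b : A) {n m : ℕ} (hnm : n ≠ m) : ψ (ρ a * s ^ n * star s ^ m * ρ b) = 0 := by
  rcases hnm.lt_or_gt with hlt | hlt
  · have h1 := hψ.word_eq_zero_of_lt hp hρ hs hsa hc hch hβ (star b) (star a) hlt
    have h2 : ρ (star b) * s ^ m * star s ^ n * ρ (star a) =
        star (ρ a * s ^ n * star s ^ m * ρ b) := by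
      simp only [star_mul, star_pow, star_star, StarHomClass.map_star, mul_assoc]
    rwa [h2, hψ.isState.map_star, star_eq_zero] at h1
  · exact hψ.word_eq_zero_of_lt hp hρ hs hsa hc hch hβ a b hlt

end KMS

/-! ### The two algebras -/

section Models

variable {A : Type u} [CStarAlgebra A] (α : A →⋆ₐ[ℂ] A) (L : A →ₗ[ℂ] A)

theorem CrossedProduct.isToeplitzPair :
    IsToeplitzPair α L ((CrossedProduct.q α L).comp (Toeplitz.ι α L))
      (CrossedProduct.q α L (Toeplitz.S α L)) where
  comm a := by
    have h1 := congrArg (CrossedProduct.q α L) ((Toeplitz.isToeplitzPair α L).comm a)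
    rwa [map_mul, map_mul] at h1
  transfer a := by
    have h1 := congrArg (CrossedProduct.q α L) ((Toeplitz.isToeplitzPair α L).transfer a)
    rwa [map_mul, map_mul, StarHomClass.map_star] at h1

variable {h : A} (hh : h ∈ Set.center A) (t : ℝ)

theorem Toeplitz.gauge_ι (a : A) : Toeplitz.gauge α L hh t (Toeplitz.ι α L a) = Toeplitz.ι α L a :=
  Toeplitz.gaugeHom_ι α L (imPow_mem_unitary h t) (imPow_mem_center hh t) a

theorem Toeplitz.gauge_S : Toeplitz.gauge α L hh t (Toeplitz.S α L) =
    Toeplitz.ι α L (imPow h t) * Toeplitz.S α L :=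
  Toeplitz.gaugeHom_S α L (imPow_mem_unitary h t) (imPow_mem_center hh t)

theorem CrossedProduct.gauge_q (x : Toeplitz α L) :
    CrossedProduct.gauge α L hh t (CrossedProduct.q α L x) =
      CrossedProduct.q α L (Toeplitz.gauge α L hh t x) := rfl

end Models

end ExelCP

theorem proposition9p4 {A : Type*} [CStarAlgebra A] [PartialOrder A] [StarOrderedRing A]
    (α : A →⋆ₐ[ℂ] A) (hα : Function.Injective α)
    (E : A →ₗ[ℂ] α.range) (hE : IsConditionalExpectation E)
    (L : A →ₗ[ℂ] A) (hL : L = transferOperator α hα E)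
    (h : A) (hcenter : h ∈ Set.center A) (hsa : IsSelfAdjoint h)
    (c : ℝ) (hc : 1 < c) (hch : algebraMap ℝ A c ≤ h)
    (β : ℝ) (hβ : 0 < β) :
    (∀ ψ : Toeplitz α L →ₗ[ℂ] ℂ, IsKMSState (Toeplitz.gauge α L hcenter) β ψ →
      ∀ (a b : A) (n m : ℕ), n ≠ m →
        ψ (Toeplitz.ι α L a * Toeplitz.S α L ^ n * star (Toeplitz.S α L) ^ m *
          Toeplitz.ι α L b) = 0) ∧
    (∀ ψ : CrossedProduct α L →ₗ[ℂ] ℂ, IsKMSState (CrossedProduct.gauge α L hcenter) β ψ →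
      ∀ (a b : A) (n m : ℕ), n ≠ m →
        ψ (CrossedProduct.q α L (Toeplitz.ι α L a) *
          CrossedProduct.q α L (Toeplitz.S α L) ^ n *
          star (CrossedProduct.q α L (Toeplitz.S α L)) ^ m *
          CrossedProduct.q α L (Toeplitz.ι α L b)) = 0) := by
  refine ⟨fun ψ hψ a b n m hnm => ?_, fun ψ hψ a b n m hnm => ?_⟩
  · exact hψ.word_eq_zero (Toeplitz.isToeplitzPair α L) (Toeplitz.gauge_ι α L hcenter)
      (Toeplitz.gauge_S α L hcenter) hsa hc hch hβ a b hnm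
  · refine hψ.word_eq_zero (CrossedProduct.isToeplitzPair α L) (fun t a => ?_) (fun t => ?_)
      hsa hc hch hβ a b hnm
    · exact (CrossedProduct.gauge_q α L hcenter t _).trans
        (congrArg (CrossedProduct.q α L) (Toeplitz.gauge_ι α L hcenter t a))
    · rw [CrossedProduct.gauge_q, Toeplitz.gauge_S, map_mul]
      rfl
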